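/- For integers $s\ge 1$ and $n\ge 0$ let $\tau_s(n)$ denote the number of standard Young tableaux with $n$ cells and at most $s$ columns (over all shapes). Then: (a) for every $s\ge 3$ and every $n\ge 1$, $$\frac{\tau_s(n)}{\tau_s(n-1)}<s;$$ (b) for every $s\ge 1$, $$\lim_{n\to\infty}\frac{\tau_s(n)}{\tau_s(n-1)}=s.$$ -/

import Mathlib

/-- A standard Young tableau of shape `μ`: a filling of the cells of `μ` with the numbers
`1, …, μ.card`, each used exactly once, strictly increasing along rows (left to right) and along
columns (top to bottom). As for Mathlib's `SemistandardYoungTableau`, cells are pairs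
`(row, column)`, and the filling is extended by zero outside `μ`, so that two tableaux are equal
exactly when their fillings agree on `μ`. -/
@[ext]
structure StandardYoungTableau (μ : YoungDiagram) where
  /-- `entry i j` is the number in the cell in row `i` and column `j`. -/
  entry : ℕ → ℕ → ℕ
  row_strict : ∀ {i j₁ j₂ : ℕ}, j₁ < j₂ → (i, j₂) ∈ μ → entry i j₁ < entry i j₂
  col_strict : ∀ {i₁ i₂ j : ℕ}, i₁ < i₂ → (i₂, j) ∈ μ → entry i₁ j < entry i₂ j
  bijOn : Set.BijOn (fun c : ℕ × ℕ => entry c.1 c.2) (μ.cells : Set (ℕ × ℕ)) (Set.Icc 1 μ.card)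
  zeros : ∀ {i j : ℕ}, (i, j) ∉ μ → entry i j = 0

/-- The set of standard Young tableaux (of any shape) with `n` cells and at most `s` columns.
The number of columns of a Young diagram is the length `μ.rowLen 0` of its first row. -/
def tableauxOfBoundedWidth (s n : ℕ) : Set (Σ μ : YoungDiagram, StandardYoungTableau μ) :=
  {T | T.1.card = n ∧ T.1.rowLen 0 ≤ s}

/-- `tau s n` is the number of standard Young tableaux with `n` cells and at most `s` columns. -/
noncomputable def tau (s n : ℕ) : ℕ :=
  (tableauxOfBoundedWidth s n).ncard

/-- The set counted by `tau s n` is finite, so `Set.ncard` is its actual cardinality. -/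
theorem tableauxOfBoundedWidth_finite (s n : ℕ) : (tableauxOfBoundedWidth s n).Finite := by
  -- The set of triples (row, column, entry) determines the tableau and lies in a finite box.
  let g : (Σ μ : YoungDiagram, StandardYoungTableau μ) → Finset (ℕ × ℕ × ℕ) :=
    fun T => T.1.cells.image fun c => (c.1, c.2, T.2.entry c.1 c.2)
  have hg : ∀ (T : Σ μ : YoungDiagram, StandardYoungTableau μ) (i j k : ℕ),
      (i, j, k) ∈ g T ↔ (i, j) ∈ T.1 ∧ T.2.entry i j = k := by
    intro T i j k
    simp only [g, Finset.mem_image, Prod.mk.injEq, Prod.exists, YoungDiagram.mem_cells]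
    constructor
    · rintro ⟨a, b, h, rfl, rfl, rfl⟩
      exact ⟨h, rfl⟩
    · rintro ⟨h, rfl⟩
      exact ⟨i, j, h, rfl, rfl, rfl⟩
  have hcells : ∀ T : Σ μ : YoungDiagram, StandardYoungTableau μ, ∀ i j : ℕ,
      (i, j) ∈ T.1 ↔ ∃ k, (i, j, k) ∈ g T := by
    intro T i j
    simp [hg]
  have hinj : Function.Injective g := by
    rintro ⟨μ, T⟩ ⟨ν, U⟩ h
    have hμν : μ = ν := by
      ext ⟨i, j⟩
      simp only [YoungDiagram.mem_cells]
      rw [hcells ⟨μ, T⟩, hcells ⟨ν, U⟩, h]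
    subst hμν
    congr 1
    ext i j
    by_cases hij : (i, j) ∈ μ
    · have h1 : (i, j, T.entry i j) ∈ g ⟨μ, T⟩ := (hg _ _ _ _).2 ⟨hij, rfl⟩
      rw [h] at h1
      exact ((hg _ _ _ _).1 h1).2.symm
    · rw [T.zeros hij, U.zeros hij]
  have hfin : (((Finset.range n ×ˢ Finset.range n ×ˢ Finset.range (n + 1)).powerset :
      Finset (Finset (ℕ × ℕ × ℕ))) : Set (Finset (ℕ × ℕ × ℕ))).Finite := Finset.finite_toSet _
  refine (hfin.preimage hinj.injOn).subset ?_
  rintro ⟨μ, T⟩ ⟨hn, -⟩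
  simp only [Set.mem_preimage, Finset.mem_coe, Finset.mem_powerset]
  rintro ⟨i, j, k⟩ h
  obtain ⟨hij, rfl⟩ := (hg _ _ _ _).1 h
  dsimp only at hn hij
  have hk := (T.bijOn.mapsTo (show ((i, j) : ℕ × ℕ) ∈ (μ.cells : Set (ℕ × ℕ)) from hij)).2
  have hi : i < μ.colLen j := YoungDiagram.mem_iff_lt_colLen.1 hij
  have hj : j < μ.rowLen i := YoungDiagram.mem_iff_lt_rowLen.1 hij
  have hc : μ.colLen j ≤ μ.card := by
    rw [YoungDiagram.colLen_eq_card]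
    exact Finset.card_le_card (Finset.filter_subset _ _)
  have hr : μ.rowLen i ≤ μ.card := by
    rw [YoungDiagram.rowLen_eq_card]
    exact Finset.card_le_card (Finset.filter_subset _ _)
  simp only [Finset.mem_product, Finset.mem_range]
  dsimp only at hk ⊢
  omega

/-! Describe a shape by its column lengths c_0 ≥ ... ≥ c_{s-1}, and let f(c) be the number of its
standard tableaux. Classifying tableaux by the cell of the largest entry gives tau_s(n+1) = s
tau_s(n) - ∑ b(c) f(c), summed over the shapes with n cells, where b(c) counts the blocked columns,
those that cannot be lengthened (`tau_succ`). The ratio is therefore at most s, and strictly less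
once some shape has a blocked column, which happens as soon as s ≥ 3. For the limit it remains to
see that blocked shapes carry a vanishing proportion of all tableaux (`tendsto_blocked_div_tau`).

The tool is Frobenius' formula f(c) = n! ∏_{i<j} (l_i - l_j) / ∏ l_i!, with l_i = c_i + s - 1 - i
(`card_fillings_eq_frobeniusCount`). A blocked shape has two equal columns, so one of the
differences is small. Adding k times the staircase (s-1, ..., 1, 0) multiplies that difference by k
+ 1 and shrinks no other. It adds M = k s(s-1)/2 cells, so n! grows by at least n^M; if c_0 ≤ r n/s,
the denominator grows by at most about (r n/s)^M. Since the translation is injective and tau_s(n+M)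
≤ s^M tau_s(n), such blocked shapes have proportion at most about r^M/(k+1) (`sum_balanced_le`).
Take k large, then r > 1 close to 1.

For shapes with c_0 > r n/s, f(c) is at most a polynomial in n times a multinomial coefficient, and
a Chernoff bound makes their total exponentially smaller than s^n (`sum_unbalanced_le`), while
tau_s(n) is at least s^n over a polynomial (`pow_le_mul_tau`). -/

/-! ### Fillings and the insertion of the largest entry -/

/-- A standard filling with entries `1, …, n` of the diagram whose column `j` has `c j` cells,
extended by zero. -/
structure IsFilling {s : ℕ} (n : ℕ) (c : Fin s → ℕ) (e : ℕ → Fin s → ℕ) : Prop where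
  ne_zero_iff : ∀ i j, e i j ≠ 0 ↔ i < c j
  row : ∀ {i : ℕ} {j₁ j₂ : Fin s}, j₁ < j₂ → i < c j₂ → e i j₁ < e i j₂
  col : ∀ {i₁ i₂ : ℕ} {j : Fin s}, i₁ < i₂ → i₂ < c j → e i₁ j < e i₂ j
  le : ∀ i j, e i j ≤ n
  surj : ∀ k, 1 ≤ k → k ≤ n → ∃ i j, e i j = k
  inj : ∀ {i i' j j'}, i < c j → i' < c j' → e i j = e i' j' → i = i' ∧ j = j'

/-- Shorten column `j` of `c` by one cell. -/
def removeCell {s : ℕ} (c : Fin s → ℕ) (j : Fin s) : Fin s → ℕ :=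
  fun b => if b = j then c j - 1 else c b

/-- Write the value `v` in the first free cell of column `j` of the shape `c`. -/
def putEntry {s : ℕ} (c : Fin s → ℕ) (j : Fin s) (v : ℕ) (e : ℕ → Fin s → ℕ) : ℕ → Fin s → ℕ :=
  fun i b => if b = j ∧ i = c j then v else e i b

open Classical in
/-- The columns of `c` whose last cell can be removed. -/
noncomputable def removableColumns {s : ℕ} (c : Fin s → ℕ) : Finset (Fin s) :=
  Finset.univ.filter fun j => 0 < c j ∧ Antitone (removeCell c j)

open Classical in
/-- The standard fillings of the shape `c`, built by inserting the largest entry last. -/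
noncomputable def fillings {s : ℕ} : ℕ → (Fin s → ℕ) → Finset (ℕ → Fin s → ℕ)
  | 0, c => if c = 0 then {0} else ∅
  | n + 1, c => (removableColumns c).biUnion fun j =>
      (fillings n (removeCell c j)).image (putEntry (removeCell c j) j (n + 1))

theorem mem_removableColumns {s : ℕ} {c : Fin s → ℕ} {j : Fin s} :
    j ∈ removableColumns c ↔ 0 < c j ∧ Antitone (removeCell c j) := by
  simp [removableColumns]

theorem IsFilling.eq_zero {s n : ℕ} {c : Fin s → ℕ} {e : ℕ → Fin s → ℕ} (h : IsFilling n c e)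
    {i : ℕ} {j : Fin s} (hij : c j ≤ i) : e i j = 0 := by
  by_contra hne
  exact absurd ((h.ne_zero_iff i j).1 hne) (by omega)

/-- Removability of column `j` says that the new cell ends both its row and its column, which is
where a new maximum may stand. -/
theorem IsFilling.put {s n : ℕ} {c : Fin s → ℕ} {e : ℕ → Fin s → ℕ} {j : Fin s}
    (hc : Antitone c) (hj : 0 < c j) (hadj : Antitone (removeCell c j))
    (h : IsFilling n (removeCell c j) e) :
    IsFilling (n + 1) c (putEntry (removeCell c j) j (n + 1) e) := by
  have hs : ∀ b, removeCell c j b = if b = j then c j - 1 else c b := fun _ => rfl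
  have hcell : ∀ i b, i < c b → (b = j ∧ i = c j - 1) ∨ i < removeCell c j b := by
    intro i b hi
    rw [hs]
    by_cases hb : b = j
    · subst hb; simp; omega
    · simp [hb, hi]
  have hput : ∀ i b, putEntry (removeCell c j) j (n + 1) e i b =
      if b = j ∧ i = c j - 1 then n + 1 else e i b := by
    intro i b
    simp [putEntry, removeCell]
  have hnot : ∀ i b, i < removeCell c j b → ¬ (b = j ∧ i = c j - 1) := by
    rintro i b hi ⟨rfl, rfl⟩
    rw [hs] at hi
    simp at hi
  have hle := h.le
  refine ⟨?_, ?_, ?_, ?_, ?_, ?_⟩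
  · intro i b
    rw [hput]
    split_ifs with hb
    · obtain ⟨rfl, rfl⟩ := hb
      simp; omega
    · rw [h.ne_zero_iff, hs]
      by_cases hbj : b = j
      · subst hbj
        simp at hb ⊢; omega
      · simp [hbj]
  · intro i j₁ j₂ hlt hi
    have hi₁ : i < c j₁ := lt_of_lt_of_le hi (hc hlt.le)
    rw [hput, hput]
    rcases hcell i j₂ hi with h2 | h2
    · rw [if_pos h2, if_neg]
      · have := hle i j₁; omega
      · rintro ⟨h3, -⟩
        exact hlt.ne (h3.trans h2.1.symm)
    · rw [if_neg (hnot _ _ h2), if_neg]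
      · exact h.row hlt h2
      -- An old cell to the right of the new one would make the shortened shape fail to be antitone.
      · rintro ⟨rfl, rfl⟩
        have := hadj hlt.le
        rw [hs, hs] at this
        rw [hs] at h2
        simp only [hlt.ne', if_false, if_true] at this h2
        omega
  · intro i₁ i₂ b hlt hi
    rw [hput, hput]
    rcases hcell i₂ b hi with h2 | h2
    · rw [if_pos h2, if_neg]
      · have := hle i₁ b; omega
      · omega
    · rw [if_neg (hnot _ _ h2), if_neg (hnot _ _ (hlt.trans h2))]
      exact h.col hlt h2
  · intro i b
    rw [hput]
    split_ifs
    · exact le_rfl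
    · exact (hle i b).trans (Nat.le_succ n)
  · intro k hk1 hk
    rcases Nat.lt_or_ge n k with hk2 | hk2
    · exact ⟨c j - 1, j, by rw [hput]; simp; omega⟩
    · obtain ⟨i, b, hib⟩ := h.surj k hk1 hk2
      refine ⟨i, b, ?_⟩
      rw [hput, if_neg, hib]
      exact hnot i b ((h.ne_zero_iff i b).1 (by omega))
  · intro i i' b b' hi hi' heq
    rw [hput, hput] at heq
    rcases hcell i b hi with h1 | h1 <;> rcases hcell i' b' hi' with h2 | h2
    · exact ⟨h1.2.trans h2.2.symm, h1.1.trans h2.1.symm⟩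
    · rw [if_pos h1, if_neg (hnot _ _ h2)] at heq
      have := hle i' b'; omega
    · rw [if_pos h2, if_neg (hnot _ _ h1)] at heq
      have := hle i b; omega
    · rw [if_neg (hnot _ _ h1), if_neg (hnot _ _ h2)] at heq
      exact h.inj h1 h2 heq

/-- Strict growth along rows and columns forces the entry `n + 1` to the end of its row and its
column, so its cell can be removed. -/
theorem IsFilling.exists_put {s n : ℕ} {c : Fin s → ℕ} {e : ℕ → Fin s → ℕ}
    (hc : Antitone c) (h : IsFilling (n + 1) c e) :
    ∃ j ∈ removableColumns c, ∃ e', IsFilling n (removeCell c j) e' ∧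
      putEntry (removeCell c j) j (n + 1) e' = e := by
  obtain ⟨i, j, hij⟩ := h.surj (n + 1) (by omega) le_rfl
  have hi : i < c j := (h.ne_zero_iff i j).1 (by omega)
  have hcj : c j = i + 1 := by
    by_contra hne
    have := h.col (show i < i + 1 by omega) (show i + 1 < c j by omega)
    have := h.le (i + 1) j
    omega
  have hright : ∀ b, j < b → c b ≤ i := by
    intro b hb
    by_contra hlt
    have := h.row hb (show i < c b by omega)
    have := h.le i b
    omega
  have hs : ∀ b, removeCell c j b = if b = j then c j - 1 else c b := fun _ => rfl
  have hc' : Antitone (removeCell c j) := by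
    intro a b hab
    have := hc hab
    rw [hs, hs]
    split_ifs with h1 h2 h2
    · exact le_rfl
    · subst h1; omega
    · subst h2
      have := hright b (lt_of_le_of_ne hab (Ne.symm h1))
      omega
    · exact this
  have hlt_iff : ∀ a b, a < removeCell c j b ↔ a < c b ∧ ¬ (b = j ∧ a = i) := by
    intro a b
    rw [hs]
    by_cases hb : b = j
    · subst hb; simp; omega
    · simp [hb]
  refine ⟨j, mem_removableColumns.2 ⟨by omega, hc'⟩,
    fun a b => if b = j ∧ a = i then 0 else e a b, ⟨?_, ?_, ?_, ?_, ?_, ?_⟩, ?_⟩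
  · intro a b
    rw [hlt_iff, ← h.ne_zero_iff]
    split_ifs with hb <;> simp [hb]
  · intro a b₁ b₂ hlt ha
    have ha₁ := lt_of_lt_of_le ha (hc' hlt.le)
    rw [hlt_iff] at ha ha₁
    rw [if_neg ha.2, if_neg ha₁.2]
    exact h.row hlt ha.1
  · intro a₁ a₂ b hlt ha
    have ha₁ := hlt.trans ha
    rw [hlt_iff] at ha ha₁
    rw [if_neg ha.2, if_neg ha₁.2]
    exact h.col hlt ha.1
  · intro a b
    split_ifs with hb
    · omega
    · by_contra hgt
      have hle := h.le a b
      have heq : e a b = e i j := by omega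
      have := h.inj ((h.ne_zero_iff a b).1 (by omega)) hi heq
      exact hb ⟨this.2, this.1⟩
  · intro k hk1 hk
    obtain ⟨a, b, hab⟩ := h.surj k hk1 (by omega)
    refine ⟨a, b, ?_⟩
    rw [if_neg, hab]
    rintro ⟨rfl, rfl⟩
    omega
  · intro a a' b b' ha ha' heq
    rw [hlt_iff] at ha ha'
    rw [if_neg ha.2, if_neg ha'.2] at heq
    exact h.inj ha.1 ha'.1 heq
  · funext a b
    simp only [putEntry, removeCell, if_true, hcj, Nat.add_sub_cancel]
    split_ifs with hb
    · obtain ⟨rfl, rfl⟩ := hb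
      exact hij.symm
    · rfl

theorem isFilling_zero_iff {s : ℕ} {c : Fin s → ℕ} {e : ℕ → Fin s → ℕ} :
    IsFilling 0 c e ↔ c = 0 ∧ e = 0 := by
  constructor
  · intro h
    have he : e = 0 := by
      funext i j
      simpa using h.le i j
    refine ⟨?_, he⟩
    funext j
    by_contra hne
    exact (h.ne_zero_iff 0 j).2 (Nat.pos_of_ne_zero hne) (by simp [he])
  · rintro ⟨rfl, rfl⟩
    refine ⟨by simp, by simp, by simp, by simp, ?_, by simp⟩
    intro k h1 h2
    omega

theorem mem_fillings {s : ℕ} (n : ℕ) {c : Fin s → ℕ} (hc : Antitone c)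
    {e : ℕ → Fin s → ℕ} : e ∈ fillings n c ↔ IsFilling n c e := by
  induction n generalizing c e with
  | zero =>
    rw [isFilling_zero_iff, fillings]
    split_ifs with h <;> simp [h]
  | succ n ih =>
    simp only [fillings, Finset.mem_biUnion, Finset.mem_image]
    constructor
    · rintro ⟨j, hj, e', he', rfl⟩
      obtain ⟨hpos, hanti⟩ := mem_removableColumns.1 hj
      exact ((ih hanti).1 he').put hc hpos hanti
    · intro h
      obtain ⟨j, hj, e', he', rfl⟩ := h.exists_put hc
      exact ⟨j, hj, e', (ih (mem_removableColumns.1 hj).2).2 he', rfl⟩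

theorem sum_removeCell {s : ℕ} {c : Fin s → ℕ} {j : Fin s} (hj : 0 < c j) :
    ∑ b, removeCell c j b + 1 = ∑ b, c b := by
  rw [← Finset.add_sum_erase _ _ (Finset.mem_univ j),
    ← Finset.add_sum_erase _ c (Finset.mem_univ j)]
  have : ∑ b ∈ Finset.univ.erase j, removeCell c j b = ∑ b ∈ Finset.univ.erase j, c b :=
    Finset.sum_congr rfl fun b hb => by simp [removeCell, Finset.ne_of_mem_erase hb]
  rw [this]
  simp only [removeCell, if_true]
  omega

theorem sum_of_mem_fillings {s : ℕ} {n : ℕ} {c : Fin s → ℕ} {e : ℕ → Fin s → ℕ}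
    (h : e ∈ fillings n c) : ∑ b, c b = n := by
  induction n generalizing c e with
  | zero =>
    rw [fillings] at h
    split_ifs at h with hc
    · simp [hc]
    · simp at h
  | succ n ih =>
    simp only [fillings, Finset.mem_biUnion, Finset.mem_image] at h
    obtain ⟨j, hj, e', he', -⟩ := h
    rw [← sum_removeCell (mem_removableColumns.1 hj).1, ih he']

/-- The old filling is recovered by erasing the new cell, where it was zero, and the position of `n
+ 1` tells the columns apart. -/
theorem card_fillings_succ {s : ℕ} (n : ℕ) (c : Fin s → ℕ) :
    (fillings (n + 1) c).card =
      ∑ j ∈ removableColumns c, (fillings n (removeCell c j)).card := by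
  classical
  rw [fillings, Finset.card_biUnion]
  · refine Finset.sum_congr rfl fun j hj => Finset.card_image_of_injOn ?_
    obtain ⟨hpos, hanti⟩ := mem_removableColumns.1 hj
    intro e₁ h₁ e₂ h₂ heq
    have h₁ := (mem_fillings n hanti).1 h₁
    have h₂ := (mem_fillings n hanti).1 h₂
    funext i b
    by_cases hb : b = j ∧ i = removeCell c j j
    · obtain ⟨rfl, rfl⟩ := hb
      rw [h₁.eq_zero le_rfl, h₂.eq_zero le_rfl]
    · have := congrFun (congrFun heq i) b
      simpa only [putEntry, if_neg hb] using this
  · intro j₁ hj₁ j₂ hj₂ hne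
    rw [Function.onFun, Finset.disjoint_left]
    intro e he₁ he₂
    obtain ⟨e₁, h₁, rfl⟩ := Finset.mem_image.1 he₁
    obtain ⟨e₂, h₂, heq⟩ := Finset.mem_image.1 he₂
    have h₂ := (mem_fillings n (mem_removableColumns.1 hj₂).2).1 h₂
    have := congrFun (congrFun heq (removeCell c j₁ j₁)) j₁
    simp only [putEntry, hne, false_and, if_false, true_and, if_true] at this
    have := h₂.le (removeCell c j₁ j₁) j₁
    omega

/-! ### Tableaux of bounded width as fillings -/

open Classical in
/-- The column-length vectors of the Young diagrams with `n` cells and at most `s` columns. -/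
noncomputable def shapes (s n : ℕ) : Finset (Fin s → ℕ) :=
  (Finset.piAntidiag Finset.univ n).filter Antitone

theorem mem_shapes {s n : ℕ} {c : Fin s → ℕ} : c ∈ shapes s n ↔ ∑ j, c j = n ∧ Antitone c := by
  simp [shapes]

/-- The Young diagram with prescribed column lengths. -/
def diagramOfColumns {s : ℕ} (c : Fin s → ℕ) (hc : Antitone c) : YoungDiagram where
  cells := Finset.univ.biUnion fun j : Fin s => (Finset.range (c j)).image fun i => (i, (j : ℕ))
  isLowerSet := by
    rintro ⟨i, j⟩ ⟨i', j'⟩ ⟨hi, hj⟩ h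
    simp only [Finset.coe_biUnion, Finset.coe_univ, Set.mem_univ, Set.iUnion_true,
      Finset.coe_image, Set.mem_iUnion, Set.mem_image, Finset.mem_coe, Finset.mem_range,
      Prod.mk.injEq] at h ⊢
    obtain ⟨b, a, hab, rfl, rfl⟩ := h
    simp only at hi hj
    exact ⟨⟨j', by omega⟩, i',
      hi.trans_lt (hab.trans_le (hc (show (⟨j', by omega⟩ : Fin s) ≤ b from hj))), rfl, rfl⟩

theorem mem_diagramOfColumns {s : ℕ} {c : Fin s → ℕ} {hc : Antitone c} {i j : ℕ} :
    (i, j) ∈ diagramOfColumns c hc ↔ ∃ h : j < s, i < c ⟨j, h⟩ := by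
  rw [← YoungDiagram.mem_cells]
  simp only [diagramOfColumns, Finset.mem_biUnion, Finset.mem_univ, true_and, Finset.mem_image,
    Finset.mem_range, Prod.mk.injEq]
  constructor
  · rintro ⟨b, a, hab, rfl, rfl⟩
    exact ⟨b.2, hab⟩
  · rintro ⟨h, hi⟩
    exact ⟨⟨j, h⟩, i, hi, rfl, rfl⟩

theorem rowLen_zero_le_iff {μ : YoungDiagram} {s : ℕ} :
    μ.rowLen 0 ≤ s ↔ ∀ i j, (i, j) ∈ μ → j < s := by
  constructor
  · intro h i j hij
    have h0 : (0, j) ∈ μ := μ.up_left_mem (Nat.zero_le _) le_rfl hij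
    exact lt_of_lt_of_le (YoungDiagram.mem_iff_lt_rowLen.1 h0) h
  · intro h
    by_contra hlt
    exact lt_irrefl _ (h 0 s (YoungDiagram.mem_iff_lt_rowLen.2 (not_le.1 hlt)))

theorem StandardYoungTableau.entry_ne_zero_iff {μ : YoungDiagram} (T : StandardYoungTableau μ)
    {i j : ℕ} : T.entry i j ≠ 0 ↔ (i, j) ∈ μ := by
  constructor
  · intro h
    by_contra hij
    exact h (T.zeros hij)
  · intro h
    have := (T.bijOn.mapsTo (show ((i, j) : ℕ × ℕ) ∈ (μ.cells : Set (ℕ × ℕ)) from h)).1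
    dsimp only at this
    omega

/-- The entries of a tableau in its first `s` columns. -/
def columnEntries (s : ℕ) (T : Σ μ : YoungDiagram, StandardYoungTableau μ) : ℕ → Fin s → ℕ :=
  fun i j => T.2.entry i j

/-- Entries inside the diagram are positive, so the shape is the support of the entries and need not
be recorded. -/
theorem columnEntries_injOn (s : ℕ) :
    Set.InjOn (columnEntries s) {T | T.1.rowLen 0 ≤ s} := by
  rintro ⟨μ, T⟩ hT ⟨ν, U⟩ hU h
  simp only [Set.mem_ofPred_eq, rowLen_zero_le_iff] at hT hU
  have hentry : ∀ i j, T.entry i j = U.entry i j := by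
    intro i j
    by_cases hj : j < s
    · exact congrFun (congrFun h i) ⟨j, hj⟩
    · rw [T.zeros fun hm => hj (hT i j hm), U.zeros fun hm => hj (hU i j hm)]
  have hμν : μ = ν := by
    ext ⟨i, j⟩
    rw [YoungDiagram.mem_cells, YoungDiagram.mem_cells, ← T.entry_ne_zero_iff,
      ← U.entry_ne_zero_iff, hentry]
  subst hμν
  congr 1
  ext i j
  exact hentry i j

theorem isFilling_columnEntries {s : ℕ} {μ : YoungDiagram} (T : StandardYoungTableau μ)
    (hμ : μ.rowLen 0 ≤ s) :
    IsFilling μ.card (fun j : Fin s => μ.colLen j) (columnEntries s ⟨μ, T⟩) := by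
  rw [rowLen_zero_le_iff] at hμ
  have hmem : ∀ {i j}, (i, j) ∈ μ ↔ i < μ.colLen j := YoungDiagram.mem_iff_lt_colLen
  refine ⟨?_, ?_, ?_, ?_, ?_, ?_⟩
  · intro i j
    rw [← hmem, ← T.entry_ne_zero_iff]
    rfl
  · intro i j₁ j₂ hlt hi
    exact T.row_strict hlt (hmem.2 hi)
  · intro i₁ i₂ j hlt hi
    exact T.col_strict hlt (hmem.2 hi)
  · intro i j
    by_cases h : (i, (j : ℕ)) ∈ μ
    · exact (T.bijOn.mapsTo (show ((i, (j : ℕ)) : ℕ × ℕ) ∈ (μ.cells : Set (ℕ × ℕ)) from h)).2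
    · exact (T.zeros h).le.trans (Nat.zero_le _)
  · intro k h1 h2
    obtain ⟨⟨i, j⟩, hij, rfl⟩ := T.bijOn.surjOn ⟨h1, h2⟩
    exact ⟨i, ⟨j, hμ i j hij⟩, rfl⟩
  · intro i i' j j' hi hi' heq
    have := T.bijOn.injOn (show ((i, (j : ℕ)) : ℕ × ℕ) ∈ (μ.cells : Set (ℕ × ℕ)) from hmem.2 hi)
      (show ((i', (j' : ℕ)) : ℕ × ℕ) ∈ (μ.cells : Set (ℕ × ℕ)) from hmem.2 hi') heq
    rw [Prod.mk.injEq] at this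
    exact ⟨this.1, Fin.ext this.2⟩

theorem IsFilling.exists_tableau {s n : ℕ} {c : Fin s → ℕ} {e : ℕ → Fin s → ℕ}
    (hc : Antitone c) (h : IsFilling n c e) :
    ∃ T ∈ tableauxOfBoundedWidth s n, columnEntries s T = e := by
  set μ := diagramOfColumns c hc with hμ
  have hmem : ∀ {i j}, (i, j) ∈ μ ↔ ∃ h : j < s, i < c ⟨j, h⟩ := mem_diagramOfColumns
  set f : ℕ → ℕ → ℕ := fun i j => if hj : j < s then e i ⟨j, hj⟩ else 0 with hf
  have hfe : ∀ i j (hj : j < s), f i j = e i ⟨j, hj⟩ := fun i j hj => by simp [hf, hj]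
  have hbij : Set.BijOn (fun a : ℕ × ℕ => f a.1 a.2) (μ.cells : Set (ℕ × ℕ)) (Set.Icc 1 n) := by
    refine ⟨?_, ?_, ?_⟩
    · rintro ⟨i, j⟩ hij
      obtain ⟨hj, hi⟩ := hmem.1 hij
      have := (h.ne_zero_iff i ⟨j, hj⟩).2 hi
      have := h.le i ⟨j, hj⟩
      simp only [hfe i j hj, Set.mem_Icc]
      omega
    · rintro ⟨i, j⟩ hij ⟨i', j'⟩ hij' heq
      obtain ⟨hj, hi⟩ := hmem.1 hij
      obtain ⟨hj', hi'⟩ := hmem.1 hij'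
      simp only [hfe i j hj, hfe i' j' hj'] at heq
      have := h.inj hi hi' heq
      simpa using this
    · rintro k ⟨h1, h2⟩
      obtain ⟨i, j, hij⟩ := h.surj k h1 h2
      refine ⟨(i, j), hmem.2 ⟨j.2, (h.ne_zero_iff i j).1 (by omega)⟩, ?_⟩
      simp only [hfe i j j.2, hij]
  have hcard : μ.card = n := by
    have h1 := hbij.injOn.ncard_image
    rw [hbij.image_eq, Set.ncard_coe_finset, ← Finset.coe_Icc, Set.ncard_coe_finset,
      Nat.card_Icc] at h1
    rw [YoungDiagram.card]
    omega
  refine ⟨⟨μ, ⟨f, ?_, ?_, hcard ▸ hbij, ?_⟩⟩, ⟨hcard, ?_⟩, ?_⟩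
  · intro i j₁ j₂ hlt hi
    obtain ⟨hj, hi⟩ := hmem.1 hi
    rw [hfe i j₁ (hlt.trans hj), hfe i j₂ hj]
    exact h.row (by exact hlt) hi
  · intro i₁ i₂ j hlt hi
    obtain ⟨hj, hi⟩ := hmem.1 hi
    rw [hfe i₁ j hj, hfe i₂ j hj]
    exact h.col hlt hi
  · intro i j hij
    by_cases hj : j < s
    · rw [hfe i j hj]
      exact h.eq_zero (not_lt.1 fun hi => hij (hmem.2 ⟨hj, hi⟩))
    · simp [hf, hj]
  · exact rowLen_zero_le_iff.2 fun i j hij => (hmem.1 hij).1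
  · funext i j
    exact hfe i j j.2

theorem tau_eq_sum_card_fillings (s n : ℕ) :
    tau s n = ∑ c ∈ shapes s n, (fillings n c).card := by
  classical
  have himage : columnEntries s '' tableauxOfBoundedWidth s n =
      ((shapes s n).biUnion (fillings n) : Finset (ℕ → Fin s → ℕ)) := by
    ext e
    simp only [Set.mem_image, Finset.coe_biUnion, Set.mem_iUnion, Finset.mem_coe, exists_prop]
    constructor
    · rintro ⟨⟨μ, T⟩, ⟨rfl, hμ⟩, rfl⟩
      have hanti : Antitone fun j : Fin s => μ.colLen j := fun a b hab => μ.colLen_anti _ _ hab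
      have hmem := (mem_fillings _ hanti).2 (isFilling_columnEntries T hμ)
      exact ⟨_, mem_shapes.2 ⟨sum_of_mem_fillings hmem, hanti⟩, hmem⟩
    · rintro ⟨c, hc, he⟩
      have hanti := (mem_shapes.1 hc).2
      exact ((mem_fillings n hanti).1 he).exists_tableau hanti
  have hinj : Set.InjOn (columnEntries s) (tableauxOfBoundedWidth s n) :=
    (columnEntries_injOn s).mono fun T hT => hT.2
  rw [tau, ← hinj.ncard_image, himage, Set.ncard_coe_finset, Finset.card_biUnion]
  -- Different shapes share no filling, again because the support determines the shape.
  intro c₁ h₁ c₂ h₂ hne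
  rw [Function.onFun, Finset.disjoint_left]
  intro e he₁ he₂
  have he₁ := (mem_fillings n (mem_shapes.1 h₁).2).1 he₁
  have he₂ := (mem_fillings n (mem_shapes.1 h₂).2).1 he₂
  refine hne (funext fun j => eq_of_forall_lt_iff fun i => ?_)
  rw [← he₁.ne_zero_iff, he₂.ne_zero_iff]

/-! ### Frobenius' formula -/

open Polynomial in
-- Both sides are the falling factorial of length `j + 1` at `x`, with its first or its last factor
-- split off.
theorem mul_eval_descPochhammer_sub_one (x : ℝ) (j : ℕ) :
    x * (descPochhammer ℝ j).eval (x - 1) = (x - j) * (descPochhammer ℝ j).eval x := by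
  have h1 := congrArg (Polynomial.eval x) (descPochhammer_succ_left ℝ j)
  rw [descPochhammer_succ_right] at h1
  simp only [eval_mul, eval_sub, eval_X, eval_natCast, eval_comp, eval_one] at h1
  linarith

/-- Falling factorials are monic of degree `j`, so they may replace the powers in the determinant;
unlike powers, they behave well under lowering `x` by one. -/
theorem det_vandermonde_eq_sum_descPochhammer {s : ℕ} (x : Fin s → ℝ) :
    (Matrix.vandermonde x).det =
      ∑ σ : Equiv.Perm (Fin s), ((Equiv.Perm.sign σ : ℤ) : ℝ) *
        ∏ i, (descPochhammer ℝ (σ i)).eval (x i) := by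
  rw [Matrix.det_eval_matrixOfPolynomials_eq_det_vandermonde x
    (fun j => descPochhammer ℝ j) (fun j => descPochhammer_natDegree (R := ℝ) j)
    (fun j => monic_descPochhammer ℝ j), ← Matrix.det_transpose, Matrix.det_apply']
  rfl

/-- The Vandermonde determinant is an eigenfunction of the weighted lowering operator. -/
theorem sum_mul_det_vandermonde_update {s : ℕ} (x : Fin s → ℝ) :
    ∑ i, x i * (Matrix.vandermonde (Function.update x i (x i - 1))).det =
      (∑ i, x i - ∑ i : Fin s, ((i : ℕ) : ℝ)) * (Matrix.vandermonde x).det := by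
  simp only [det_vandermonde_eq_sum_descPochhammer, Finset.mul_sum]
  rw [Finset.sum_comm]
  refine Finset.sum_congr rfl fun σ _ => ?_
  -- Weighted lowering of coordinate `i` multiplies the term of `σ` by `x i - σ i`, and the sum of
  -- these factors over `i` does not depend on `σ`.
  have hprod : ∀ i, x i * ∏ k, (descPochhammer ℝ (σ k)).eval (Function.update x i (x i - 1) k) =
      (x i - (σ i : ℕ)) * ∏ k, (descPochhammer ℝ (σ k)).eval (x k) := by
    intro i
    rw [← Finset.mul_prod_erase _ _ (Finset.mem_univ i),
      ← Finset.mul_prod_erase _ (fun k => (descPochhammer ℝ (σ k)).eval (x k))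
        (Finset.mem_univ i), ← mul_assoc, ← mul_assoc, Function.update_self,
      mul_eval_descPochhammer_sub_one]
    congr 1
    refine Finset.prod_congr rfl fun k hk => ?_
    rw [Function.update_of_ne (Finset.ne_of_mem_erase hk)]
  have hperm : ∑ i, ((σ i : ℕ) : ℝ) = ∑ i : Fin s, ((i : ℕ) : ℝ) :=
    Equiv.sum_comp σ fun i => ((i : ℕ) : ℝ)
  calc _ = ∑ i, ((Equiv.Perm.sign σ : ℤ) : ℝ) *
        ((x i - (σ i : ℕ)) * ∏ k, (descPochhammer ℝ (σ k)).eval (x k)) := by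
        refine Finset.sum_congr rfl fun i _ => ?_
        rw [← hprod]
        ring
    _ = _ := by
        rw [← Finset.mul_sum, ← Finset.sum_mul, Finset.sum_sub_distrib, hperm]
        ring

/-- The product of all differences `x i - x j` with `i < j`. -/
noncomputable def diffProd {s : ℕ} (x : Fin s → ℝ) : ℝ :=
  ∏ p : (_ : Fin s) × Fin s with p.1 < p.2, (x p.1 - x p.2)

theorem univ_filter_lt_eq_sigma (s : ℕ) :
    Finset.univ.filter (fun p : (_ : Fin s) × Fin s => p.1 < p.2) =
      Finset.univ.sigma fun i => Finset.Ioi i := by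
  ext ⟨i, j⟩
  simp

/-- The sign is left unevaluated: it is the same on both sides of every identity linear in
`diffProd`. -/
theorem diffProd_eq {s : ℕ} (x : Fin s → ℝ) :
    diffProd x = (∏ p : (_ : Fin s) × Fin s with p.1 < p.2, (-1 : ℝ)) *
      (Matrix.vandermonde x).det := by
  rw [Matrix.det_vandermonde, Finset.prod_sigma', diffProd, univ_filter_lt_eq_sigma,
    ← Finset.prod_mul_distrib]
  refine Finset.prod_congr rfl fun p _ => ?_
  ring

theorem sum_mul_diffProd_update {s : ℕ} (x : Fin s → ℝ) :
    ∑ i, x i * diffProd (Function.update x i (x i - 1)) =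
      (∑ i, x i - ∑ i : Fin s, ((i : ℕ) : ℝ)) * diffProd x := by
  simp only [diffProd_eq]
  rw [mul_left_comm, ← sum_mul_det_vandermonde_update, Finset.mul_sum]
  refine Finset.sum_congr rfl fun i _ => ?_
  ring

theorem diffProd_eq_zero {s : ℕ} {x : Fin s → ℝ} {i j : Fin s} (hij : i < j) (h : x i = x j) :
    diffProd x = 0 :=
  Finset.prod_eq_zero (i := ⟨i, j⟩) (by simpa using hij) (by simp [h])

/-- The strictly decreasing sequence attached to the column lengths `c`. -/
def shifted {s : ℕ} (c : Fin s → ℕ) (i : Fin s) : ℕ := c i + (Fin.rev i : ℕ)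

/-- Frobenius' formula for the number of standard tableaux with column lengths `c`. -/
noncomputable def frobeniusCount {s : ℕ} (c : Fin s → ℕ) : ℝ :=
  (∑ i, c i).factorial * diffProd (fun i => (shifted c i : ℝ)) / ∏ i, ((shifted c i).factorial : ℝ)

theorem sum_fin_rev (s : ℕ) : ∑ i : Fin s, (Fin.rev i : ℕ) = ∑ i : Fin s, (i : ℕ) :=
  Equiv.sum_comp Fin.revPerm fun i : Fin s => (i : ℕ)

/-- Pulling one factor out of the `j`-th factorial gives all removals a common prefactor and the
weight required by `sum_mul_diffProd_update`. -/
theorem frobeniusCount_removeCell {s : ℕ} {c : Fin s → ℕ} {j : Fin s} {n : ℕ} (hj : 0 < c j)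
    (hn : ∑ i, removeCell c j i = n) :
    frobeniusCount (removeCell c j) = (n.factorial : ℝ) / (∏ i, ((shifted c i).factorial : ℝ)) *
      (shifted c j * diffProd (Function.update (fun i => (shifted c i : ℝ)) j (shifted c j - 1))) := by
  have hx : (fun i => (shifted (removeCell c j) i : ℝ)) =
      Function.update (fun i => (shifted c i : ℝ)) j (shifted c j - 1) := by
    funext i
    by_cases h : i = j
    · subst h
      rw [Function.update_self, eq_sub_iff_add_eq]
      norm_cast
      simp only [shifted, removeCell, if_true]
      omega
    · rw [Function.update_of_ne h]
      simp [shifted, removeCell, h]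
  have hprod : ∏ i, ((shifted c i).factorial : ℝ) =
      shifted c j * ∏ i, ((shifted (removeCell c j) i).factorial : ℝ) := by
    rw [← Finset.mul_prod_erase _ _ (Finset.mem_univ j),
      ← Finset.mul_prod_erase _ (fun i => ((shifted (removeCell c j) i).factorial : ℝ))
        (Finset.mem_univ j), ← mul_assoc]
    congr 1
    · have h1 : shifted c j = shifted (removeCell c j) j + 1 := by
        simp only [shifted, removeCell, if_true]
        omega
      rw [h1, Nat.factorial_succ]
      push_cast
      ring
    · refine Finset.prod_congr rfl fun i hi => ?_
      simp [shifted, removeCell, Finset.ne_of_mem_erase hi]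
  have hl : (shifted c j : ℝ) ≠ 0 := by
    have : 0 < shifted c j := Nat.add_pos_left hj _
    positivity
  have hpos : ∏ i, ((shifted (removeCell c j) i).factorial : ℝ) ≠ 0 :=
    Finset.prod_ne_zero_iff.2 fun i _ => by positivity
  rw [frobeniusCount, hn, hx, hprod]
  field_simp

/-- If the next column is equally long, lowering makes two shifted lengths coincide; if `j` is the
last column and empty, the weight itself is zero. -/
theorem shifted_mul_diffProd_eq_zero {s : ℕ} {c : Fin s → ℕ} (hc : Antitone c) {j : Fin s}
    (hj : j ∉ removableColumns c) :
    (shifted c j : ℝ) *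
      diffProd (Function.update (fun i => (shifted c i : ℝ)) j (shifted c j - 1)) = 0 := by
  by_cases hlast : (j : ℕ) + 1 < s
  · set k : Fin s := ⟨j + 1, hlast⟩ with hk
    have hjk : j < k := Fin.lt_def.2 (Nat.lt_succ_self _)
    rcases (hc hjk.le).eq_or_lt with heq | hlt
    · rw [diffProd_eq_zero hjk, mul_zero]
      rw [Function.update_self, Function.update_of_ne hjk.ne', sub_eq_iff_eq_add]
      norm_cast
      have hkv : (k : ℕ) = j + 1 := rfl
      simp only [shifted, Fin.val_rev, heq, hkv]
      omega
    · refine absurd (mem_removableColumns.2 ⟨by omega, ?_⟩) hj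
      intro a b hab
      have h1 := hc hab
      simp only [removeCell]
      split_ifs with hb ha ha
      · exact le_rfl
      · subst hb; omega
      · subst ha
        have : k ≤ b := by
          rw [Fin.le_def]
          have := lt_of_le_of_ne hab (Ne.symm hb)
          rw [Fin.lt_def] at this
          exact this
        have := hc this
        omega
      · exact h1
  · rcases Nat.eq_zero_or_pos (c j) with h0 | hpos
    · have : shifted c j = 0 := by
        simp only [shifted, Fin.val_rev, h0]
        omega
      simp [this]
    · refine absurd (mem_removableColumns.2 ⟨hpos, ?_⟩) hj
      intro a b hab
      have h1 := hc hab
      simp only [removeCell]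
      split_ifs with hb ha ha
      · exact le_rfl
      · subst hb; omega
      · subst ha
        exact absurd (Fin.ext (by have := b.2; rw [Fin.le_def] at hab; omega)) hb
      · exact h1

/-- The sum extends to all columns because the extra terms vanish; the eigenvalue of the lowering
operator is then `n + 1`, which turns `n!` into `(n + 1)!`. -/
theorem frobeniusCount_eq_sum {s : ℕ} {c : Fin s → ℕ} (hc : Antitone c) {n : ℕ}
    (hn : ∑ i, c i = n + 1) :
    frobeniusCount c = ∑ j ∈ removableColumns c, frobeniusCount (removeCell c j) := by
  have hs : ∀ j ∈ removableColumns c, ∑ i, removeCell c j i = n := by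
    intro j hj
    have h := mem_removableColumns.1 hj
    by_contra hne
    have := sum_removeCell h.1
    omega
  rw [Finset.sum_congr rfl fun j hj =>
    frobeniusCount_removeCell (mem_removableColumns.1 hj).1 (hs j hj), ← Finset.mul_sum,
    Finset.sum_subset (Finset.subset_univ _) fun j _ hj => shifted_mul_diffProd_eq_zero hc hj,
    sum_mul_diffProd_update, frobeniusCount, hn, Nat.factorial_succ]
  have : (∑ i, (shifted c i : ℝ)) - ∑ i : Fin s, ((i : ℕ) : ℝ) = n + 1 := by
    rw [sub_eq_iff_eq_add]
    have h2 : ∑ i, shifted c i = n + 1 + ∑ i : Fin s, (i : ℕ) := by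
      simp only [shifted, Finset.sum_add_distrib]
      rw [sum_fin_rev, hn]
    exact_mod_cast h2
  rw [this]
  push_cast
  ring

open Nat in
theorem prod_fin_factorial (n : ℕ) : ∏ i : Fin (n + 1), (i : ℕ)! = superFactorial n := by
  induction n with
  | zero => simp
  | succ n ih => rw [Fin.prod_univ_castSucc, superFactorial_succ, ← ih, mul_comm]; simp

/-- The shifted lengths are `s - 1, ..., 0`, whose difference product and product of factorials are
the same superfactorial. -/
theorem frobeniusCount_zero (s : ℕ) : frobeniusCount (0 : Fin s → ℕ) = 1 := by
  have hdiff : diffProd (fun i : Fin s => (shifted 0 i : ℝ)) =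
      (Matrix.vandermonde fun i : Fin s => ((i : ℕ) : ℝ)).det := by
    rw [Matrix.det_vandermonde, Finset.prod_sigma', diffProd, univ_filter_lt_eq_sigma]
    refine Finset.prod_congr rfl fun p _ => ?_
    have h : ∀ i : Fin s, (shifted 0 i : ℝ) + (i : ℕ) = s - 1 := by
      intro i
      rw [eq_sub_iff_add_eq]
      norm_cast
      simp only [shifted, Fin.val_rev, Pi.zero_apply]
      omega
    linarith [h p.1, h p.2]
  have hprod : ∏ i : Fin s, (shifted 0 i).factorial = ∏ i : Fin s, (i : ℕ).factorial := by
    simp only [shifted, Pi.zero_apply, zero_add]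
    exact Equiv.prod_comp Fin.revPerm fun i : Fin s => (i : ℕ).factorial
  have hdet : (Matrix.vandermonde fun i : Fin s => ((i : ℕ) : ℝ)).det =
      ∏ i : Fin s, ((i : ℕ).factorial : ℝ) := by
    rcases s with _ | n
    · simp
    · rw [Matrix.det_vandermonde_id_eq_superFactorial, ← prod_fin_factorial]
      push_cast
      rfl
  have hcast : ∏ i : Fin s, ((shifted 0 i).factorial : ℝ) =
      ∏ i : Fin s, ((i : ℕ).factorial : ℝ) := by exact_mod_cast hprod
  have hpos : ∏ i : Fin s, ((i : ℕ).factorial : ℝ) ≠ 0 :=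
    Finset.prod_ne_zero_iff.2 fun i _ => by positivity
  rw [frobeniusCount, hdiff, hdet, hcast]
  simp [hpos]

theorem card_fillings_eq_frobeniusCount {s : ℕ} (n : ℕ) {c : Fin s → ℕ} (hc : Antitone c)
    (hn : ∑ i, c i = n) : ((fillings n c).card : ℝ) = frobeniusCount c := by
  induction n generalizing c with
  | zero =>
    have h0 : c = 0 := by
      funext i
      exact Finset.sum_eq_zero_iff.1 hn i (Finset.mem_univ i)
    subst h0
    rw [fillings, if_pos rfl, Finset.card_singleton, Nat.cast_one, frobeniusCount_zero]
  | succ n ih =>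
    rw [card_fillings_succ, frobeniusCount_eq_sum hc hn, Nat.cast_sum]
    refine Finset.sum_congr rfl fun j hj => ?_
    have h := mem_removableColumns.1 hj
    refine ih h.2 ?_
    have := sum_removeCell h.1
    omega

theorem tau_eq_sum_frobeniusCount (s n : ℕ) :
    (tau s n : ℝ) = ∑ c ∈ shapes s n, frobeniusCount c := by
  rw [tau_eq_sum_card_fillings, Nat.cast_sum]
  exact Finset.sum_congr rfl fun c hc =>
    card_fillings_eq_frobeniusCount n (mem_shapes.1 hc).2 (mem_shapes.1 hc).1

/-! ### Positivity of the counts -/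

theorem shifted_sub_shifted {s : ℕ} (c : Fin s → ℕ) (i j : Fin s) :
    (shifted c i : ℝ) - shifted c j = ((c i : ℝ) - c j) + ((j : ℕ) - (i : ℕ)) := by
  have h : ∀ i : Fin s, (shifted c i : ℝ) + (i : ℕ) = c i + (s - 1) := by
    intro i
    have : shifted c i + (i : ℕ) + 1 = c i + s := by
      simp only [shifted, Fin.val_rev]
      omega
    have : (shifted c i : ℝ) + (i : ℕ) + 1 = c i + s := by exact_mod_cast this
    linarith
  linarith [h i, h j]

theorem one_le_shifted_sub_shifted {s : ℕ} {c : Fin s → ℕ} (hc : Antitone c) {i j : Fin s}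
    (hij : i < j) : (1 : ℝ) ≤ (shifted c i : ℝ) - shifted c j := by
  rw [shifted_sub_shifted]
  have h1 : (c j : ℝ) ≤ c i := by exact_mod_cast hc hij.le
  have h2 : ((i : ℕ) : ℝ) + 1 ≤ (j : ℕ) := by exact_mod_cast hij
  linarith

theorem one_le_diffProd_shifted {s : ℕ} {c : Fin s → ℕ} (hc : Antitone c) :
    1 ≤ diffProd (fun i => (shifted c i : ℝ)) :=
  Finset.prod_induction _ (fun x : ℝ => 1 ≤ x) (fun _ _ => one_le_mul_of_one_le_of_one_le) le_rfl
    fun p hp => one_le_shifted_sub_shifted hc (by simpa using hp)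

theorem frobeniusCount_pos {s : ℕ} {c : Fin s → ℕ} (hc : Antitone c) : 0 < frobeniusCount c := by
  have := one_le_diffProd_shifted hc
  rw [frobeniusCount]
  have h2 : 0 < ∏ i, ((shifted c i).factorial : ℝ) := Finset.prod_pos fun i _ => by positivity
  positivity

/-! ### The recurrence in `n` and the strict bound -/

/-- Lengthen column `j` of `c` by one cell. -/
def addCell {s : ℕ} (c : Fin s → ℕ) (j : Fin s) : Fin s → ℕ :=
  fun b => if b = j then c j + 1 else c b

theorem removeCell_addCell {s : ℕ} (c : Fin s → ℕ) (j : Fin s) :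
    removeCell (addCell c j) j = c := by
  funext b
  by_cases h : b = j
  · subst h; simp [removeCell, addCell]
  · simp [removeCell, addCell, h]

theorem addCell_removeCell {s : ℕ} {c : Fin s → ℕ} {j : Fin s} (hj : 0 < c j) :
    addCell (removeCell c j) j = c := by
  funext b
  by_cases h : b = j
  · subst h; simp [removeCell, addCell]; omega
  · simp [removeCell, addCell, h]

open Classical in
/-- The columns of `c` that cannot be lengthened by one cell. -/
noncomputable def blockedColumns {s : ℕ} (c : Fin s → ℕ) : Finset (Fin s) :=
  Finset.univ.filter fun j => ¬ Antitone (addCell c j)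

theorem mem_blockedColumns {s : ℕ} {c : Fin s → ℕ} {j : Fin s} :
    j ∈ blockedColumns c ↔ ¬ Antitone (addCell c j) := by
  simp [blockedColumns]

/-- Pairs of a shape and a removable column correspond to pairs of a smaller shape and a column that
can be lengthened; of the `s` columns exactly the blocked ones fail. -/
theorem tau_succ (s n : ℕ) : (tau s (n + 1) : ℝ) =
    s * tau s n - ∑ c ∈ shapes s n, (blockedColumns c).card * frobeniusCount c := by
  classical
  have h1 : (tau s (n + 1) : ℝ) =
      ∑ c ∈ shapes s n, ∑ j with Antitone (addCell c j), frobeniusCount c := by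
    rw [tau_eq_sum_frobeniusCount, Finset.sum_congr rfl fun c hc =>
      frobeniusCount_eq_sum (mem_shapes.1 hc).2 (mem_shapes.1 hc).1, Finset.sum_sigma',
      Finset.sum_sigma']
    refine Finset.sum_bij' (fun p _ => ⟨removeCell p.1 p.2, p.2⟩)
      (fun p _ => ⟨addCell p.1 p.2, p.2⟩) ?_ ?_ ?_ ?_ ?_
    · rintro ⟨c, j⟩ h
      simp only [Finset.mem_sigma, mem_shapes, mem_removableColumns, Finset.mem_filter,
        Finset.mem_univ, true_and] at h ⊢
      refine ⟨⟨?_, h.2.2⟩, ?_⟩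
      · have := sum_removeCell h.2.1
        omega
      · rw [addCell_removeCell h.2.1]
        exact h.1.2
    · rintro ⟨c, j⟩ h
      simp only [Finset.mem_sigma, mem_shapes, mem_removableColumns, Finset.mem_filter,
        Finset.mem_univ, true_and] at h ⊢
      have hpos : 0 < addCell c j j := by simp [addCell]
      refine ⟨⟨?_, h.2⟩, hpos, ?_⟩
      · have := sum_removeCell hpos
        rw [removeCell_addCell] at this
        omega
      · rw [removeCell_addCell]
        exact h.1.2
    · rintro ⟨c, j⟩ h
      simp only [Finset.mem_sigma, mem_removableColumns] at h
      simp only [addCell_removeCell h.2.1]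
    · rintro ⟨c, j⟩ h
      simp only [removeCell_addCell]
    · rintro ⟨c, j⟩ h
      rfl
  rw [h1, tau_eq_sum_frobeniusCount, Finset.mul_sum, ← Finset.sum_sub_distrib]
  refine Finset.sum_congr rfl fun c _ => ?_
  rw [Finset.sum_const, nsmul_eq_mul, ← sub_mul]
  congr 1
  rw [eq_sub_iff_add_eq]
  have := Finset.card_filter_add_card_filter_not (s := (Finset.univ : Finset (Fin s)))
    (fun j => Antitone (addCell c j))
  rw [Finset.card_univ, Fintype.card_fin] at this
  rw [blockedColumns]
  exact_mod_cast this

theorem exists_mem_shapes {s : ℕ} (hs : 1 ≤ s) (n : ℕ) :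
    (fun i : Fin s => if (i : ℕ) = 0 then n else 0) ∈ shapes s n := by
  rw [mem_shapes]
  constructor
  · rw [Finset.sum_eq_single ⟨0, hs⟩]
    · simp
    · intro b _ hb
      exact if_neg fun h => hb (Fin.ext h)
    · simp
  · intro a b hab
    rw [Fin.le_def] at hab
    dsimp only
    split_ifs <;> omega

theorem tau_pos {s : ℕ} (hs : 1 ≤ s) (n : ℕ) : (0 : ℝ) < tau s n := by
  rw [tau_eq_sum_frobeniusCount]
  exact Finset.sum_pos (fun c hc => frobeniusCount_pos (mem_shapes.1 hc).2)
    ⟨_, exists_mem_shapes hs n⟩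

theorem tau_succ_le (s n : ℕ) : (tau s (n + 1) : ℝ) ≤ s * tau s n := by
  rw [tau_succ, sub_le_self_iff]
  exact Finset.sum_nonneg fun c hc =>
    mul_nonneg (Nat.cast_nonneg _) (frobeniusCount_pos (mem_shapes.1 hc).2).le

theorem tau_add_le (s n m : ℕ) : (tau s (n + m) : ℝ) ≤ s ^ m * tau s n := by
  induction m with
  | zero => simp
  | succ m ih =>
    calc (tau s (n + (m + 1)) : ℝ) ≤ s * tau s (n + m) := tau_succ_le s (n + m)
      _ ≤ s * (s ^ m * tau s n) := by gcongr
      _ = s ^ (m + 1) * tau s n := by ring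

theorem tau_succ_lt {s : ℕ} (hs : 3 ≤ s) (n : ℕ) : (tau s (n + 1) : ℝ) < s * tau s n := by
  rw [tau_succ, sub_lt_self_iff]
  refine Finset.sum_pos' (fun c hc =>
    mul_nonneg (Nat.cast_nonneg _) (frobeniusCount_pos (mem_shapes.1 hc).2).le)
    ⟨_, exists_mem_shapes (by omega) n, ?_⟩
  refine mul_pos ?_ (frobeniusCount_pos (mem_shapes.1 (exists_mem_shapes (by omega) n)).2)
  rw [Nat.cast_pos, Finset.card_pos]
  -- In the one-column shape the columns with indices 1 and 2 are both empty, so the latter is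
  -- blocked.
  refine ⟨⟨2, hs⟩, mem_blockedColumns.2 fun h => ?_⟩
  have := h (show (⟨1, by omega⟩ : Fin s) ≤ ⟨2, hs⟩ by simp)
  simp [addCell] at this

theorem tau_div_lt {s : ℕ} (hs : 3 ≤ s) {n : ℕ} (hn : 1 ≤ n) :
    (tau s n : ℝ) / tau s (n - 1) < s := by
  obtain ⟨m, rfl⟩ := Nat.exists_eq_add_of_le' hn
  rw [Nat.add_sub_cancel, div_lt_iff₀ (tau_pos (by omega) m)]
  exact tau_succ_lt hs m

/-! ### Translation by a staircase -/

/-- Adding a staircase to the column lengths. -/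
def addStair {s : ℕ} (k : ℕ) (c : Fin s → ℕ) : Fin s → ℕ := fun i => c i + k * (Fin.rev i : ℕ)

theorem shifted_addStair_sub (k : ℕ) {s : ℕ} (c : Fin s → ℕ) (i j : Fin s) :
    (shifted (addStair k c) i : ℝ) -
      shifted (addStair k c) j =
      ((shifted c i : ℝ) - shifted c j) + k * ((j : ℕ) - (i : ℕ)) := by
  have h : ∀ i : Fin s, ((Fin.rev i : ℕ) : ℝ) + (i : ℕ) = s - 1 := by
    intro i
    rw [eq_sub_iff_add_eq]
    norm_cast
    simp only [Fin.val_rev]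
    omega
  simp only [shifted, addStair]
  push_cast
  have : ((j : ℕ) : ℝ) - (i : ℕ) = (Fin.rev i : ℕ) - (Fin.rev j : ℕ) := by linarith [h i, h j]
  rw [this]
  ring

theorem addStair_injective {s : ℕ} (k : ℕ) :
    Function.Injective (addStair k : (Fin s → ℕ) → Fin s → ℕ) := fun c d h => by
  funext i
  simpa [addStair] using congrFun h i

theorem addStair_mem_shapes {s n : ℕ} (k : ℕ) {c : Fin s → ℕ} (hc : c ∈ shapes s n) :
    addStair k c ∈ shapes s (n + k * ∑ i : Fin s, (Fin.rev i : ℕ)) := by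
  rw [mem_shapes] at hc ⊢
  refine ⟨?_, fun a b hab => ?_⟩
  · simp only [addStair, Finset.sum_add_distrib, hc.1, Finset.mul_sum]
  · exact Nat.add_le_add (hc.2 hab) (Nat.mul_le_mul_left _ (Fin.rev_le_rev.2 hab))

/-- The factor of the equal pair grows from `j - i` to `(k + 1) * (j - i)`; the other factors are
positive and do not decrease. -/
theorem mul_diffProd_le_diffProd_addStair {s : ℕ} (k : ℕ) {c : Fin s → ℕ} (hc : Antitone c)
    {i j : Fin s} (hij : i < j) (heq : c i = c j) :
    (k + 1) * diffProd (fun i => (shifted c i : ℝ)) ≤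
      diffProd (fun i => (shifted (addStair k c) i : ℝ)) := by
  have hmem : (⟨i, j⟩ : (_ : Fin s) × Fin s) ∈
      Finset.univ.filter (fun p : (_ : Fin s) × Fin s => p.1 < p.2) := by simpa using hij
  rw [diffProd, diffProd, ← Finset.mul_prod_erase _ _ hmem, ← Finset.mul_prod_erase _ _ hmem,
    ← mul_assoc]
  refine mul_le_mul ?_ (Finset.prod_le_prod ?_ ?_) (Finset.prod_nonneg ?_) ?_
  · rw [shifted_addStair_sub, shifted_sub_shifted, heq]
    linarith
  · intro p hp
    have := one_le_shifted_sub_shifted hc (by simpa using Finset.mem_of_mem_erase hp)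
    linarith
  · intro p hp
    have hlt : p.1 < p.2 := by simpa using Finset.mem_of_mem_erase hp
    have : ((p.1 : ℕ) : ℝ) ≤ (p.2 : ℕ) := by exact_mod_cast hlt.le
    rw [shifted_addStair_sub, le_add_iff_nonneg_right]
    exact mul_nonneg (Nat.cast_nonneg _) (by linarith)
  · intro p hp
    have := one_le_shifted_sub_shifted hc (by simpa using Finset.mem_of_mem_erase hp)
    linarith
  · have : ((i : ℕ) : ℝ) ≤ (j : ℕ) := by exact_mod_cast hij.le
    have h1 := one_le_shifted_sub_shifted hc hij
    rw [shifted_addStair_sub]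
    have := mul_nonneg (Nat.cast_nonneg k : (0 : ℝ) ≤ k) (sub_nonneg.2 this)
    linarith

theorem factorial_add_le (a m : ℕ) : (a + m).factorial ≤ a.factorial * (a + m) ^ m := by
  rw [← Nat.factorial_mul_ascFactorial]
  exact Nat.mul_le_mul_left _ (Nat.ascFactorial_le_pow_add a m)

/-- Each of the `M` added cells contributes at least `n` to the numerator's factorial and at most
`U` to the denominator; the difference product contributes `k + 1`. -/
theorem frobeniusCount_le_addStair {s n : ℕ} (k : ℕ) {c : Fin s → ℕ} (hc : c ∈ shapes s n)
    {i j : Fin s} (hij : i < j) (heq : c i = c j) {U : ℝ}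
    (hU : ∀ i, (c i : ℝ) + s + k * s ≤ U) :
    (n : ℝ) ^ (k * ∑ i : Fin s, (Fin.rev i : ℕ)) * (k + 1) * frobeniusCount c ≤
      U ^ (k * ∑ i : Fin s, (Fin.rev i : ℕ)) * frobeniusCount (addStair k c) := by
  set M := k * ∑ i : Fin s, (Fin.rev i : ℕ) with hM
  have hc' := addStair_mem_shapes k hc
  rw [mem_shapes] at hc hc'
  have hdiff := mul_diffProd_le_diffProd_addStair k hc.2 hij heq
  have hfac : (n : ℝ) ^ M * n.factorial ≤ (n + M).factorial := by
    have h1 : n.factorial * (n + 1) ^ M ≤ (n + M).factorial := Nat.factorial_mul_pow_le_factorial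
    have h2 : n ^ M * n.factorial ≤ (n + M).factorial :=
      le_trans (by rw [mul_comm]; gcongr; omega) h1
    exact_mod_cast h2
  have hprod : ∏ i, ((shifted (addStair k c) i).factorial : ℝ) ≤
      U ^ M * ∏ i, ((shifted c i).factorial : ℝ) := by
    rw [hM, Finset.mul_sum, ← Finset.prod_pow_eq_pow_sum, ← Finset.prod_mul_distrib]
    refine Finset.prod_le_prod (fun _ _ => Nat.cast_nonneg _) fun i _ => ?_
    have h1 : shifted (addStair k c) i = shifted c i + k * (Fin.rev i : ℕ) := by
      simp only [shifted, addStair]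
      ring
    have h2 := factorial_add_le (shifted c i) (k * (Fin.rev i : ℕ))
    have h3 : ((shifted c i + k * (Fin.rev i : ℕ) : ℕ) : ℝ) ≤ U := by
      refine le_trans ?_ (hU i)
      have hrev : (Fin.rev i : ℕ) ≤ s := (Fin.rev i).2.le
      have : shifted c i + k * (Fin.rev i : ℕ) ≤ c i + s + k * s := by
        rw [shifted]
        gcongr
      exact_mod_cast this
    rw [h1]
    calc ((shifted c i + k * (Fin.rev i : ℕ)).factorial : ℝ)
        ≤ ((shifted c i).factorial : ℝ) *
          ((shifted c i + k * (Fin.rev i : ℕ) : ℕ) : ℝ) ^ (k * (Fin.rev i : ℕ)) := by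
            exact_mod_cast h2
      _ ≤ ((shifted c i).factorial : ℝ) * U ^ (k * (Fin.rev i : ℕ)) := by gcongr
      _ = _ := mul_comm _ _
  have hpos : 0 < ∏ i, ((shifted c i).factorial : ℝ) :=
    Finset.prod_pos fun i _ => by positivity
  have hpos' : 0 < ∏ i, ((shifted (addStair k c) i).factorial : ℝ) :=
    Finset.prod_pos fun i _ => by positivity
  have hd := one_le_diffProd_shifted hc.2
  have hd' := one_le_diffProd_shifted hc'.2
  rw [frobeniusCount, frobeniusCount, hc.1, hc'.1, ← mul_div_assoc, ← mul_div_assoc,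
    div_le_div_iff₀ hpos hpos']
  calc _ = ((n : ℝ) ^ M * n.factorial) * ((k + 1) * diffProd (fun i => (shifted c i : ℝ))) *
        ∏ i, ((shifted (addStair k c) i).factorial : ℝ) := by ring
    _ ≤ (n + M).factorial * diffProd (fun i => (shifted (addStair k c) i : ℝ)) *
        (U ^ M * ∏ i, ((shifted c i).factorial : ℝ)) := by gcongr
    _ = _ := by ring

/-! ### Comparison with multinomial coefficients -/

theorem coe_multinomial_eq {s n : ℕ} {c : Fin s → ℕ} (hn : ∑ i, c i = n) :
    (Nat.multinomial Finset.univ c : ℝ) = n.factorial / ∏ i, ((c i).factorial : ℝ) := by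
  rw [eq_div_iff (Finset.prod_ne_zero_iff.2 fun i _ => by positivity), mul_comm, ← hn]
  exact_mod_cast Nat.multinomial_spec Finset.univ c

theorem shifted_le {s n : ℕ} {c : Fin s → ℕ} (hn : ∑ i, c i = n) (i : Fin s) :
    shifted c i ≤ n + s := by
  have h1 : c i ≤ n := hn ▸ Finset.single_le_sum (fun _ _ => Nat.zero_le _) (Finset.mem_univ i)
  have h2 : (Fin.rev i : ℕ) ≤ s := (Fin.rev i).2.le
  exact Nat.add_le_add h1 h2

/-- The difference product has at most `s * s` factors, each at most `n + s`, and shifting only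
enlarges the denominator. -/
theorem frobeniusCount_le_multinomial {s n : ℕ} (hs : 1 ≤ s) {c : Fin s → ℕ}
    (hc : c ∈ shapes s n) :
    frobeniusCount c ≤ (n + s : ℝ) ^ (s * s) * Nat.multinomial Finset.univ c := by
  rw [mem_shapes] at hc
  have h1 : (1 : ℝ) ≤ n + s := by exact_mod_cast (by omega : 1 ≤ n + s)
  have hdiff : diffProd (fun i => (shifted c i : ℝ)) ≤ (n + s : ℝ) ^ (s * s) := by
    calc diffProd (fun i => (shifted c i : ℝ))
        ≤ ∏ p : (_ : Fin s) × Fin s with p.1 < p.2, (n + s : ℝ) := by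
          refine Finset.prod_le_prod (fun p hp => ?_) fun p hp => ?_
          · have := one_le_shifted_sub_shifted hc.2 (by simpa using hp)
            linarith
          · have h2 : (shifted c p.1 : ℝ) ≤ n + s := by exact_mod_cast shifted_le hc.1 p.1
            have h3 : (0 : ℝ) ≤ shifted c p.2 := Nat.cast_nonneg _
            linarith
      _ ≤ (n + s : ℝ) ^ (s * s) := by
          rw [Finset.prod_const]
          refine pow_le_pow_right₀ h1 ((Finset.card_filter_le _ _).trans ?_)
          simp
  have hpos : 0 < ∏ i, ((c i).factorial : ℝ) := Finset.prod_pos fun i _ => by positivity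
  have hprod : ∏ i, ((c i).factorial : ℝ) ≤ ∏ i, ((shifted c i).factorial : ℝ) :=
    Finset.prod_le_prod (fun _ _ => Nat.cast_nonneg _) fun i _ => by
      exact_mod_cast Nat.factorial_le (Nat.le_add_right _ _)
  have hd := one_le_diffProd_shifted hc.2
  rw [frobeniusCount, hc.1, coe_multinomial_eq hc.1, ← mul_div_assoc,
    mul_comm (n.factorial : ℝ)]
  gcongr

/-- The difference product is at least one, and shifting multiplies each of the `s` factorials by at
most `(n + s) ^ s`. -/
theorem multinomial_le_frobeniusCount {s n : ℕ} (hs : 1 ≤ s) {c : Fin s → ℕ}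
    (hc : c ∈ shapes s n) :
    (Nat.multinomial Finset.univ c : ℝ) ≤ (n + s : ℝ) ^ (s * s) * frobeniusCount c := by
  rw [mem_shapes] at hc
  have h1 : (1 : ℝ) ≤ n + s := by exact_mod_cast (by omega : 1 ≤ n + s)
  have hprod : ∏ i, ((shifted c i).factorial : ℝ) ≤
      (n + s : ℝ) ^ (s * s) * ∏ i, ((c i).factorial : ℝ) := by
    have hconst : (n + s : ℝ) ^ (s * s) = ∏ _i : Fin s, (n + s : ℝ) ^ s := by
      rw [Finset.prod_const, Finset.card_univ, Fintype.card_fin, pow_mul]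
    rw [hconst, ← Finset.prod_mul_distrib]
    refine Finset.prod_le_prod (fun _ _ => Nat.cast_nonneg _) fun i _ => ?_
    calc ((shifted c i).factorial : ℝ)
        ≤ (c i).factorial * ((shifted c i : ℕ) : ℝ) ^ (Fin.rev i : ℕ) := by
          exact_mod_cast factorial_add_le (c i) (Fin.rev i)
      _ ≤ (c i).factorial * (n + s : ℝ) ^ (Fin.rev i : ℕ) := by
          gcongr
          exact_mod_cast shifted_le hc.1 i
      _ ≤ (c i).factorial * (n + s : ℝ) ^ s := by
          gcongr
          exact (Fin.rev i).2.le
      _ = _ := mul_comm _ _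
  have hpos : 0 < ∏ i, ((c i).factorial : ℝ) := Finset.prod_pos fun i _ => by positivity
  have hpos' : 0 < ∏ i, ((shifted c i).factorial : ℝ) :=
    Finset.prod_pos fun i _ => by positivity
  have hd := one_le_diffProd_shifted hc.2
  rw [frobeniusCount, hc.1, coe_multinomial_eq hc.1, ← mul_div_assoc,
    div_le_div_iff₀ hpos hpos']
  calc (n.factorial : ℝ) * ∏ i, ((shifted c i).factorial : ℝ)
      ≤ n.factorial * ((n + s : ℝ) ^ (s * s) * ∏ i, ((c i).factorial : ℝ)) := by gcongr
    _ ≤ n.factorial * ((n + s : ℝ) ^ (s * s) * ∏ i, ((c i).factorial : ℝ)) *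
        diffProd (fun i => (shifted c i : ℝ)) := le_mul_of_one_le_right (by positivity) hd
    _ = _ := by ring

theorem multinomial_comp_perm {s : ℕ} (c : Fin s → ℕ) (σ : Equiv.Perm (Fin s)) :
    (Nat.multinomial Finset.univ (c ∘ σ) : ℝ) = Nat.multinomial Finset.univ c := by
  rw [coe_multinomial_eq rfl, coe_multinomial_eq rfl]
  rw [show ∑ i, (c ∘ σ) i = ∑ i, c i from Equiv.sum_comp σ c]
  congr 1
  exact Equiv.prod_comp σ fun i => ((c i).factorial : ℝ)

theorem exists_perm_antitone {s : ℕ} (c : Fin s → ℕ) :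
    ∃ σ : Equiv.Perm (Fin s), Antitone (c ∘ σ) :=
  ⟨Fin.revPerm.trans (Tuple.sort c), fun _ _ hab =>
    Tuple.monotone_sort c (Fin.rev_le_rev.2 hab)⟩

theorem card_piAntidiag_le (s n : ℕ) :
    (Finset.piAntidiag (Finset.univ : Finset (Fin s)) n).card ≤ (n + 1) ^ s := by
  have hsub : Finset.piAntidiag (Finset.univ : Finset (Fin s)) n ⊆
      Fintype.piFinset fun _ => Finset.range (n + 1) := by
    intro c hc
    rw [Finset.mem_piAntidiag] at hc
    rw [Fintype.mem_piFinset]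
    intro i
    rw [Finset.mem_range, Nat.lt_succ_iff, ← hc.1]
    exact Finset.single_le_sum (fun _ _ => Nat.zero_le _) (Finset.mem_univ i)
  refine (Finset.card_le_card hsub).trans ?_
  simp

/-- The multinomial theorem writes `s ^ n` as a sum of at most `(n + 1) ^ s` coefficients; sorting
the parts turns each index into a shape without changing its coefficient. -/
theorem pow_le_mul_tau {s : ℕ} (hs : 1 ≤ s) (n : ℕ) :
    (s : ℝ) ^ n ≤ (n + 1) ^ s * (n + s : ℝ) ^ (s * s) * tau s n := by
  have hterm : ∀ c ∈ Finset.piAntidiag (Finset.univ : Finset (Fin s)) n,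
      (Nat.multinomial Finset.univ c : ℝ) ≤ (n + s : ℝ) ^ (s * s) * tau s n := by
    intro c hc
    obtain ⟨σ, hσ⟩ := exists_perm_antitone c
    have hmem : c ∘ σ ∈ shapes s n :=
      mem_shapes.2 ⟨(Equiv.sum_comp σ c).trans (Finset.mem_piAntidiag.1 hc).1, hσ⟩
    rw [← multinomial_comp_perm c σ]
    refine (multinomial_le_frobeniusCount hs hmem).trans ?_
    rw [tau_eq_sum_frobeniusCount]
    gcongr
    exact Finset.single_le_sum
      (fun d hd => (frobeniusCount_pos (mem_shapes.1 hd).2).le) hmem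
  have hsum := Finset.sum_pow_eq_sum_piAntidiag (Finset.univ : Finset (Fin s))
    (fun _ => (1 : ℝ)) n
  simp only [Finset.sum_const, Finset.card_univ, Fintype.card_fin, nsmul_eq_mul, mul_one,
    one_pow, Finset.prod_const_one] at hsum
  rw [hsum]
  refine (Finset.sum_le_card_nsmul _ _ _ hterm).trans ?_
  rw [nsmul_eq_mul, mul_assoc]
  gcongr
  exact_mod_cast card_piAntidiag_le s n

/-! ### Blocked shapes are negligible -/

theorem exists_lt_eq_of_mem_blockedColumns {s : ℕ} {c : Fin s → ℕ} (hc : Antitone c) {j : Fin s}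
    (hj : j ∈ blockedColumns c) : ∃ a < j, c a = c j := by
  rw [mem_blockedColumns] at hj
  by_contra! hne
  refine hj fun a b hab => ?_
  have h1 := hc hab
  simp only [addCell]
  split_ifs with hb ha ha
  · exact le_rfl
  · subst hb
    have := hne a (lt_of_le_of_ne hab ha)
    omega
  · subst ha; omega
  · exact h1

/-- The shapes with `n` cells and a blocked column. -/
noncomputable def blockedShapes (s n : ℕ) : Finset (Fin s → ℕ) :=
  (shapes s n).filter fun c => (blockedColumns c).Nonempty

theorem mul_tau_sub_le (s n : ℕ) :
    s * (tau s n : ℝ) - tau s (n + 1) ≤ s * ∑ c ∈ blockedShapes s n, frobeniusCount c := by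
  rw [tau_succ, sub_sub_cancel, blockedShapes, Finset.sum_filter, Finset.mul_sum]
  refine Finset.sum_le_sum fun c hc => ?_
  split_ifs with h
  · have hcard : (blockedColumns c).card ≤ s := (Finset.card_le_univ _).trans (by simp)
    have := (frobeniusCount_pos (mem_shapes.1 hc).2).le
    gcongr
  · rw [Finset.not_nonempty_iff_eq_empty.1 h]
    simp

/-- Blocked shapes with a short first column are outnumbered by their staircase translates. -/
theorem sum_balanced_le {s : ℕ} (hs : 1 ≤ s) (k n : ℕ) (r : ℝ) (hr : 0 ≤ r) :
    (n : ℝ) ^ (k * ∑ i : Fin s, (Fin.rev i : ℕ)) * (k + 1) *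
      ∑ c ∈ blockedShapes s n with (s : ℝ) * c ⟨0, hs⟩ ≤ r * n, frobeniusCount c ≤
      (r * n + s * (s + k * s)) ^ (k * ∑ i : Fin s, (Fin.rev i : ℕ)) * tau s n := by
  set M := k * ∑ i : Fin s, (Fin.rev i : ℕ) with hM
  have hs0 : (0 : ℝ) < s := by exact_mod_cast hs
  -- Every column is at most the first, hence at most `r * n / s`; the terms `s` and `k * s` allow
  -- for the shift and the staircase.
  set U : ℝ := r * n / s + s + k * s with hU
  have hU0 : 0 ≤ U := by positivity
  calc _ = ∑ c ∈ blockedShapes s n with (s : ℝ) * c ⟨0, hs⟩ ≤ r * n,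
        (n : ℝ) ^ M * (k + 1) * frobeniusCount c := Finset.mul_sum _ _ _
    _ ≤ ∑ c ∈ blockedShapes s n with (s : ℝ) * c ⟨0, hs⟩ ≤ r * n,
        U ^ M * frobeniusCount (addStair k c) := by
        refine Finset.sum_le_sum fun c hc => ?_
        simp only [blockedShapes, Finset.mem_filter] at hc
        obtain ⟨⟨hc, j, hj⟩, hr⟩ := hc
        have hanti := (mem_shapes.1 hc).2
        obtain ⟨a, haj, heq⟩ := exists_lt_eq_of_mem_blockedColumns hanti hj
        refine frobeniusCount_le_addStair k hc haj heq fun i => ?_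
        have h1 : (c i : ℝ) ≤ c ⟨0, hs⟩ := by
          exact_mod_cast hanti (show (⟨0, hs⟩ : Fin s) ≤ i from Nat.zero_le _)
        have h2 : (c ⟨0, hs⟩ : ℝ) ≤ r * n / s := by
          rw [le_div_iff₀ hs0]
          linarith
        linarith
    _ = U ^ M * ∑ d ∈ (Finset.filter (fun c => (s : ℝ) * c ⟨0, hs⟩ ≤ r * n)
          (blockedShapes s n)).image (addStair k), frobeniusCount d := by
        rw [Finset.sum_image ((addStair_injective k).injOn), Finset.mul_sum]
    _ ≤ U ^ M * tau s (n + M) := by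
        rw [tau_eq_sum_frobeniusCount]
        refine mul_le_mul_of_nonneg_left ?_ (by positivity)
        refine Finset.sum_le_sum_of_subset_of_nonneg ?_ fun d hd _ =>
          (frobeniusCount_pos (mem_shapes.1 hd).2).le
        intro d hd
        obtain ⟨c, hc, rfl⟩ := Finset.mem_image.1 hd
        simp only [blockedShapes, Finset.mem_filter] at hc
        exact addStair_mem_shapes k hc.1.1
    -- Returning from `n + M` cells to `n` costs `s ^ M`, which combines with `U ^ M` into `(s * U)
    -- ^ M`.
    _ ≤ U ^ M * (s ^ M * tau s n) := by
        gcongr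
        exact tau_add_le s n M
    _ = _ := by
        rw [← mul_assoc, ← mul_pow, hU]
        congr 2
        field_simp
        ring

/-- Chernoff's bound for the shapes with a long first column. -/
theorem sum_unbalanced_le {s : ℕ} (hs : 1 ≤ s) (n : ℕ) (r t : ℝ) (ht : 0 ≤ t) :
    ∑ c ∈ blockedShapes s n with ¬ (s : ℝ) * c ⟨0, hs⟩ ≤ r * n, frobeniusCount c ≤
      (n + s : ℝ) ^ (s * s) * ((s - 1 + Real.exp (t * s)) * Real.exp (-(t * r))) ^ n := by
  -- Exponential tilting: in the multinomial theorem the first column gets weight `exp (t * s)` and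
  -- the others weight one.
  set x : Fin s → ℝ := fun i => if i = ⟨0, hs⟩ then Real.exp (t * s) else 1 with hx
  have hxsum : ∑ i, x i = s - 1 + Real.exp (t * s) := by
    rw [← Finset.add_sum_erase _ _ (Finset.mem_univ ⟨0, hs⟩),
      Finset.sum_congr rfl fun i hi => if_neg (Finset.ne_of_mem_erase hi)]
    simp [hx, Nat.cast_sub hs]
    ring
  have hxprod : ∀ c : Fin s → ℕ, ∏ i, x i ^ c i = Real.exp (t * s) ^ c ⟨0, hs⟩ := by
    intro c
    rw [Finset.prod_eq_single ⟨0, hs⟩]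
    · simp [hx]
    · intro b _ hb
      simp [hx, hb]
    · simp
  rw [mul_pow, ← hxsum, Finset.sum_pow_eq_sum_piAntidiag, Finset.sum_mul, Finset.mul_sum]
  refine (Finset.sum_le_sum fun c hc => ?_).trans
    (Finset.sum_le_sum_of_subset_of_nonneg (s := Finset.filter
      (fun c => ¬ (s : ℝ) * c ⟨0, hs⟩ ≤ r * n) (blockedShapes s n)) ?_ ?_)
  · simp only [blockedShapes, Finset.mem_filter, not_le] at hc
    refine (frobeniusCount_le_multinomial hs hc.1.1).trans ?_
    rw [hxprod, mul_assoc]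
    refine mul_le_mul_of_nonneg_left (le_mul_of_one_le_right (Nat.cast_nonneg _) ?_)
      (by positivity)
    rw [← Real.exp_nat_mul, ← Real.exp_nat_mul, ← Real.exp_add, Real.one_le_exp_iff]
    have := mul_nonneg ht (sub_nonneg.2 hc.2.le)
    linarith
  · intro c hc
    simp only [blockedShapes, Finset.mem_filter, mem_shapes] at hc
    simp [hc.1.1.1]
  · intro c _ _
    rw [hxprod]
    positivity

/-- At `t = 0` the left side equals `s` and has derivative `s * (1 - r) < 0`, so a small positive
`t` works. -/
theorem exists_exponential_decay {s : ℕ} (hs : 1 ≤ s) {r : ℝ} (hr : 1 < r) :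
    ∃ t : ℝ, 0 ≤ t ∧ (s - 1 + Real.exp (t * s)) * Real.exp (-(t * r)) < s := by
  have hs0 : (0 : ℝ) < s := by exact_mod_cast hs
  have h1 : HasDerivAt (fun t : ℝ => Real.exp (t * s)) (s : ℝ) 0 := by
    have := ((hasDerivAt_id (0 : ℝ)).mul_const (s : ℝ)).exp
    simpa using this
  have h2 : HasDerivAt (fun t : ℝ => Real.exp (-(t * r))) (-r) 0 := by
    have := ((hasDerivAt_id (0 : ℝ)).mul_const r).neg.exp
    simpa using this
  have h3 := (h1.const_add ((s : ℝ) - 1)).mul h2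
  simp only [zero_mul, neg_zero, Real.exp_zero, mul_one, sub_add_cancel] at h3
  have hneg : (s : ℝ) + s * -r < 0 := by nlinarith
  have hlim := (hasDerivAt_iff_tendsto_slope.1 h3).mono_left
    (nhdsWithin_mono 0 fun x (hx : x ∈ Set.Ioi (0 : ℝ)) => ne_of_gt hx)
  obtain ⟨t, ht, htpos⟩ := ((hlim.eventually (gt_mem_nhds hneg)).and self_mem_nhdsWithin).exists
  have htpos : 0 < t := htpos
  refine ⟨t, htpos.le, ?_⟩
  rw [slope_def_field, sub_zero, div_lt_iff₀ htpos, zero_mul] at ht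
  simpa using ht

theorem tendsto_unbalanced_div_tau {s : ℕ} (hs : 1 ≤ s) {r : ℝ} (hr : 1 < r) :
    Filter.Tendsto (fun n : ℕ => (∑ c ∈ blockedShapes s n with ¬ (s : ℝ) * c ⟨0, hs⟩ ≤ r * n,
      frobeniusCount c) / tau s n) Filter.atTop (nhds 0) := by
  obtain ⟨t, ht, hlt⟩ := exists_exponential_decay hs hr
  have hs0 : (0 : ℝ) < s := by exact_mod_cast hs
  have hs1 : (1 : ℝ) ≤ s := by exact_mod_cast hs
  set q : ℝ := (s - 1 + Real.exp (t * s)) * Real.exp (-(t * r)) with hq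
  have hq0 : 0 ≤ q := by
    have := Real.exp_pos (t * s)
    have : (0 : ℝ) ≤ s - 1 + Real.exp (t * s) := by linarith
    positivity
  have hθ : q / s < 1 := (div_lt_one hs0).2 hlt
  -- One `s * s` comes from the bound on the long-column shapes, the rest from the lower bound on
  -- `tau`; for `n ≥ 1` all polynomial bases are at most `(1 + s) * n`.
  have hlim := (tendsto_pow_const_mul_const_pow_of_abs_lt_one (s + s * s + s * s)
    (by rwa [abs_of_nonneg (by positivity)] : |q / s| < 1)).const_mul
    ((1 + s : ℝ) ^ (s + s * s + s * s))
  rw [mul_zero] at hlim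
  refine squeeze_zero' (Filter.Eventually.of_forall fun n => ?_) ?_ hlim
  · refine div_nonneg (Finset.sum_nonneg fun c hc => ?_) (Nat.cast_nonneg _)
    simp only [blockedShapes, Finset.mem_filter] at hc
    exact (frobeniusCount_pos (mem_shapes.1 hc.1.1).2).le
  · filter_upwards [Filter.eventually_ge_atTop 1] with n hn
    have hn1 : (1 : ℝ) ≤ n := by exact_mod_cast hn
    rw [div_le_iff₀ (tau_pos hs n)]
    refine (sum_unbalanced_le hs n r t ht).trans ?_
    rw [← hq]
    have hpow : q ^ n = (q / s) ^ n * s ^ n := by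
      rw [← mul_pow, div_mul_cancel₀ _ hs0.ne']
    have hb1 : (n + 1 : ℝ) ≤ (1 + s) * n := by nlinarith
    have hb2 : (n + s : ℝ) ≤ (1 + s) * n := by nlinarith
    have hτ := (tau_pos hs n).le
    calc (n + s : ℝ) ^ (s * s) * q ^ n
        ≤ (n + s : ℝ) ^ (s * s) * ((q / s) ^ n *
          ((n + 1) ^ s * (n + s : ℝ) ^ (s * s) * tau s n)) := by
          rw [hpow]
          gcongr
          exact pow_le_mul_tau hs n
      _ ≤ ((1 + s) * n : ℝ) ^ (s * s) * ((q / s) ^ n *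
          (((1 + s) * n) ^ s * ((1 + s) * n : ℝ) ^ (s * s) * tau s n)) := by
          gcongr
      _ = _ := by
          simp only [mul_pow, pow_add]
          ring

theorem tendsto_blocked_div_tau {s : ℕ} (hs : 1 ≤ s) :
    Filter.Tendsto (fun n : ℕ => (∑ c ∈ blockedShapes s n, frobeniusCount c) / tau s n)
      Filter.atTop (nhds 0) := by
  have hnonneg : ∀ n, ∀ c ∈ blockedShapes s n, 0 ≤ frobeniusCount c := fun n c hc =>
    (frobeniusCount_pos (mem_shapes.1 (Finset.mem_filter.1 hc).1).2).le
  have key : ∀ ε > (0 : ℝ), ∀ᶠ n : ℕ in Filter.atTop,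
      (∑ c ∈ blockedShapes s n, frobeniusCount c) / tau s n < ε := by
    intro ε hε
    -- The order of choices matters: `k` depends on `ε`, then `r` on the exponent `M`, and only then
    -- is `n` taken large.
    obtain ⟨k, hk⟩ := exists_nat_gt (4 / ε)
    have hk1 : 2 / ((k : ℝ) + 1) < ε / 2 := by
      rw [div_lt_iff₀ hε] at hk
      rw [div_lt_iff₀ (by positivity)]
      nlinarith
    set M := k * ∑ i : Fin s, (Fin.rev i : ℕ) with hM
    obtain ⟨r, hr2, hr1⟩ : ∃ r : ℝ, r ^ M < 2 ∧ 1 < r := by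
      have hcont : Filter.Tendsto (fun r : ℝ => r ^ M) (nhdsWithin 1 (Set.Ioi 1)) (nhds 1) := by
        have h := (continuous_pow M (M := ℝ)).tendsto 1
        rw [one_pow] at h
        exact h.mono_left nhdsWithin_le_nhds
      exact ((hcont.eventually (gt_mem_nhds one_lt_two)).and self_mem_nhdsWithin).exists
    have hlim : Filter.Tendsto (fun n : ℕ => (r + (s * (s + k * s) : ℝ) / n) ^ M) Filter.atTop
        (nhds (r ^ M)) := by
      have h := ((tendsto_const_div_atTop_nhds_zero_nat (s * (s + k * s) : ℝ)).const_add r).pow M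
      rwa [add_zero] at h
    filter_upwards [hlim.eventually (gt_mem_nhds hr2), Filter.eventually_ge_atTop 1,
      (tendsto_unbalanced_div_tau hs hr1).eventually (gt_mem_nhds (half_pos hε))]
      with n hn2 hn1 hbad
    have hn0 : (0 : ℝ) < n := by exact_mod_cast hn1
    have hτ := tau_pos hs n
    have hgood := sum_balanced_le hs k n r (by linarith)
    rw [← hM] at hgood
    have hfac : (r * n + s * (s + k * s) : ℝ) = n * (r + (s * (s + k * s) : ℝ) / n) := by
      field_simp
    rw [hfac, mul_pow, mul_assoc, mul_assoc, mul_le_mul_iff_right₀ (pow_pos hn0 M)] at hgood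
    have hgood2 : (∑ c ∈ blockedShapes s n with (s : ℝ) * c ⟨0, hs⟩ ≤ r * n,
        frobeniusCount c) / tau s n ≤ 2 / ((k : ℝ) + 1) := by
      rw [div_le_div_iff₀ hτ (by positivity), mul_comm]
      exact hgood.trans (by gcongr)
    rw [← Finset.sum_filter_add_sum_filter_not (blockedShapes s n)
      (fun c => (s : ℝ) * c ⟨0, hs⟩ ≤ r * n), add_div]
    linarith
  rw [Metric.tendsto_nhds]
  intro ε hε
  filter_upwards [key ε hε] with n hn
  rwa [Real.dist_eq, sub_zero,
    abs_of_nonneg (div_nonneg (Finset.sum_nonneg (hnonneg n)) (Nat.cast_nonneg _))]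

/-- The ratio lies between `s` minus `s` times the proportion of blocked shapes, and `s`. -/
theorem tendsto_tau_ratio {s : ℕ} (hs : 1 ≤ s) :
    Filter.Tendsto (fun n : ℕ => (tau s n : ℝ) / (tau s (n - 1) : ℝ)) Filter.atTop
      (nhds (s : ℝ)) := by
  rw [← Filter.tendsto_add_atTop_iff_nat 1]
  have h := ((tendsto_blocked_div_tau hs).const_mul (s : ℝ)).const_sub (s : ℝ)
  rw [mul_zero, sub_zero] at h
  refine tendsto_of_tendsto_of_tendsto_of_le_of_le h tendsto_const_nhds (fun n => ?_) fun n => ?_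
  · have hτ := tau_pos hs n
    have := mul_tau_sub_le s n
    simp only [Nat.add_sub_cancel]
    rw [le_div_iff₀ hτ, sub_mul, mul_assoc, div_mul_cancel₀ _ hτ.ne']
    linarith
  · simp only [Nat.add_sub_cancel]
    rw [div_le_iff₀ (tau_pos hs n)]
    exact tau_succ_le s n

theorem proposition11 (s : ℕ) (hs : 1 ≤ s) :
    (3 ≤ s → ∀ n : ℕ, 1 ≤ n → (tau s n : ℝ) / (tau s (n - 1) : ℝ) < (s : ℝ)) ∧
    Filter.Tendsto (fun n : ℕ => (tau s n : ℝ) / (tau s (n - 1) : ℝ)) Filter.atTop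
      (nhds (s : ℝ)) :=
  ⟨fun hs3 _ hn => tau_div_lt hs3 hn, tendsto_tau_ratio hs⟩
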